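/- Let $(\mathfrak g,\omega)$ be an eight-dimensional symplectic Lie algebra, i.e. an eight-dimensional real Lie algebra $\mathfrak g$ with a non-degenerate alternating bilinear form $\omega$ satisfying $\omega([x,y],z)+\omega([y,z],x)+\omega([z,x],y)=0$ for all $x,y,z\in\mathfrak g$. An ideal $\mathfrak j$ of a symplectic Lie algebra is isotropic if $\mathfrak j\subset\mathfrak j^{\perp}$, where $\mathfrak j^{\perp}=\{x : \omega(x,y)=0\text{ for all }y\in\mathfrak j\}$; the symplectic reduction with respect to an isotropic ideal $\mathfrak j$ is the Lie algebra $\mathfrak j^{\perp}/\mathfrak j$ with the symplectic form induced by $\omega$. Call $(\mathfrak g,\omega)$ non completely reducible if there is no finite sequence of successive symplectic reductions, starting from $(\mathfrak g,\omega)$, that ends in the trivial symplectic Lie algebra $\{0\}$. If $(\mathfrak g,\omega)$ is non completely reducible, then the Lie algebra $\mathfrak g$ is solvable. -/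

import Mathlib

universe u

/-- A symplectic form on a real Lie algebra: an alternating, non-degenerate bilinear form which is
closed for the Chevalley-Eilenberg differential. -/
structure SymplecticForm (g : Type u) [LieRing g] [LieAlgebra ℝ g] where
  form : LinearMap.BilinForm ℝ g
  alt : ∀ x, form x x = 0
  nondegenerate : ∀ x, (∀ y, form x y = 0) → x = 0
  closed : ∀ x y z, form ⁅x, y⁆ z + form ⁅y, z⁆ x + form ⁅z, x⁆ y = 0

namespace SymplecticForm

variable {g : Type u} [LieRing g] [LieAlgebra ℝ g] (ω : SymplecticForm g)

theorem skew (x y : g) : ω.form x y = -ω.form y x := by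
  have h := ω.alt (x + y)
  simp only [map_add, LinearMap.add_apply, ω.alt, zero_add, add_zero] at h
  linarith

/-- The `ω`-orthogonal of an ideal `j`, a Lie subalgebra:
all `x` with `ω(x, y) = 0` for every `y ∈ j`. -/
def orthogonal (j : LieIdeal ℝ g) : LieSubalgebra ℝ g where
  carrier := {x | ∀ y ∈ j, ω.form x y = 0}
  add_mem' := by
    intro a b ha hb y hy
    simp [ha y hy, hb y hy]
  zero_mem' := by
    intro y _
    simp
  smul_mem' := by
    intro c x hx y hy
    simp [hx y hy]
  lie_mem' := by
    intro x y hx hy z hz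
    have h := ω.closed x y z
    have h1 : ω.form ⁅y, z⁆ x = 0 := by
      rw [ω.skew, hx _ (lie_mem_right ℝ g j y z hz), neg_zero]
    have h2 : ω.form ⁅z, x⁆ y = 0 := by
      rw [ω.skew, hy _ (lie_mem_left ℝ g j z x hz), neg_zero]
    linarith

theorem mem_orthogonal {j : LieIdeal ℝ g} {x : g} :
    x ∈ ω.orthogonal j ↔ ∀ y ∈ j, ω.form x y = 0 := Iff.rfl

/-- The ideal `j` is isotropic: it is contained in its `ω`-orthogonal. -/
def IsIsotropic (j : LieIdeal ℝ g) : Prop := ∀ x ∈ j, x ∈ ω.orthogonal j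

/-- `j ∩ j^⊥`, as an ideal of the Lie algebra `j^⊥`. For an isotropic `j` this is `j` itself. -/
def idealInOrthogonal (j : LieIdeal ℝ g) : LieIdeal ℝ (ω.orthogonal j) :=
  LieIdeal.comap (ω.orthogonal j).incl j

theorem mem_idealInOrthogonal {j : LieIdeal ℝ g} {x : ω.orthogonal j} :
    x ∈ ω.idealInOrthogonal j ↔ (x : g) ∈ j := by
  simp [idealInOrthogonal]

/-- The Lie algebra `j^⊥ / j`. -/
abbrev ReductionCarrier (j : LieIdeal ℝ g) : Type u :=
  ω.orthogonal j ⧸ ω.idealInOrthogonal j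

/-- The bilinear form induced by `ω` on `j^⊥ / j`. -/
noncomputable def reductionForm (j : LieIdeal ℝ g) :
    LinearMap.BilinForm ℝ (ω.ReductionCarrier j) :=
  Submodule.liftQ (ω.idealInOrthogonal j).toSubmodule
    { toFun := fun x => Submodule.liftQ (ω.idealInOrthogonal j).toSubmodule
        ((ω.form (x : g)).comp (ω.orthogonal j).toSubmodule.subtype)
        (fun y hy => x.2 y (ω.mem_idealInOrthogonal.1 hy))
      map_add' := by
        intro a b
        apply Submodule.linearMap_qext
        ext y
        exact LinearMap.congr_fun (map_add ω.form (a : g) (b : g)) (y : g)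
      map_smul' := by
        intro c a
        apply Submodule.linearMap_qext
        ext y
        exact LinearMap.congr_fun (map_smul ω.form c (a : g)) (y : g) }
    (by
      intro x hx
      apply Submodule.linearMap_qext
      ext y
      change ω.form (x : g) (y : g) = 0
      rw [ω.skew, y.2 _ (ω.mem_idealInOrthogonal.1 hx), neg_zero])

theorem reductionForm_mk (j : LieIdeal ℝ g) (x y : ω.orthogonal j) :
    ω.reductionForm j (LieSubmodule.Quotient.mk x) (LieSubmodule.Quotient.mk y)
      = ω.form (x : g) (y : g) := rfl

/-- An element orthogonal to `j^⊥` lies in `j`. -/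
theorem mem_of_orthogonal_orthogonal [FiniteDimensional ℝ g] (j : LieIdeal ℝ g) (x : g)
    (h : ∀ y ∈ ω.orthogonal j, ω.form x y = 0) : x ∈ j := by
  have hrefl : ω.form.IsRefl := fun a b hab => by rw [ω.skew, hab, neg_zero]
  have hnd : ω.form.Nondegenerate := by
    refine ⟨ω.nondegenerate, fun a ha => ω.nondegenerate a fun b => ?_⟩
    rw [ω.skew, ha, neg_zero]
  have key := LinearMap.BilinForm.orthogonal_orthogonal hnd hrefl j.toSubmodule
  have : x ∈ ω.form.orthogonal (ω.form.orthogonal j.toSubmodule) := by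
    intro y hy
    change ω.form y x = 0
    rw [ω.skew, h y ?_, neg_zero]
    intro z hz
    rw [ω.skew, hy z hz, neg_zero]
  rw [key] at this
  exact this

/-- The symplectic form induced by `ω` on `j^⊥ / j`. -/
noncomputable def reduction [FiniteDimensional ℝ g] (j : LieIdeal ℝ g) (_hj : ω.IsIsotropic j) :
    SymplecticForm (ω.ReductionCarrier j) where
  form := ω.reductionForm j
  alt := by
    intro x
    obtain ⟨x, rfl⟩ := LieSubmodule.Quotient.surjective_mk' _ x
    exact ω.alt x
  nondegenerate := by
    intro x hx
    obtain ⟨x, rfl⟩ := LieSubmodule.Quotient.surjective_mk' _ x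
    refine (LieSubmodule.Quotient.mk_eq_zero' (N := ω.idealInOrthogonal j)).2 ?_
    rw [mem_idealInOrthogonal]
    exact ω.mem_of_orthogonal_orthogonal j x
      fun y hy => hx (LieSubmodule.Quotient.mk (⟨y, hy⟩ : ω.orthogonal j))
  closed := by
    intro x y z
    obtain ⟨x, rfl⟩ := LieSubmodule.Quotient.surjective_mk' _ x
    obtain ⟨y, rfl⟩ := LieSubmodule.Quotient.surjective_mk' _ y
    obtain ⟨z, rfl⟩ := LieSubmodule.Quotient.surjective_mk' _ z
    exact ω.closed x y z

end SymplecticForm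

/-- A symplectic Lie algebra `(g, ω)`: a finite-dimensional real Lie algebra with a symplectic
form. -/
structure SymplecticLieAlgebra where
  carrier : Type u
  [lieRing : LieRing carrier]
  [lieAlgebra : LieAlgebra ℝ carrier]
  [finiteDimensional : FiniteDimensional ℝ carrier]
  omega : SymplecticForm carrier

namespace SymplecticLieAlgebra

attribute [instance] lieRing lieAlgebra finiteDimensional

/-- The symplectic reduction of `(g, ω)` with respect to an isotropic ideal `j`: the quotient
`j^⊥ / j` with the form induced by `ω`. -/
noncomputable def reduction (S : SymplecticLieAlgebra.{u}) (j : LieIdeal ℝ S.carrier)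
    (hj : S.omega.IsIsotropic j) : SymplecticLieAlgebra.{u} where
  carrier := S.omega.ReductionCarrier j
  finiteDimensional :=
    inferInstanceAs (FiniteDimensional ℝ
      ((S.omega.orthogonal j) ⧸ (S.omega.idealInOrthogonal j).toSubmodule))
  omega := S.omega.reduction j hj

/-- `S.ReducesTo T`: there is a finite sequence of successive symplectic reductions from `S`
to `T`. -/
inductive ReducesTo (S : SymplecticLieAlgebra.{u}) : SymplecticLieAlgebra.{u} → Prop
  | refl : ReducesTo S S
  | step {T : SymplecticLieAlgebra.{u}} (h : ReducesTo S T) (j : LieIdeal ℝ T.carrier)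
      (hj : T.omega.IsIsotropic j) : ReducesTo S (T.reduction j hj)

/-- A symplectic Lie algebra is completely reducible if it can be symplectically reduced to the
trivial (zero) symplectic Lie algebra. -/
def IsCompletelyReducible (S : SymplecticLieAlgebra.{u}) : Prop :=
  ∃ T : SymplecticLieAlgebra.{u}, S.ReducesTo T ∧ Subsingleton T.carrier

end SymplecticLieAlgebra

/-! Call a symplectic Lie algebra irreducible if it has no nonzero isotropic ideal. In the
irreducible case let `a` be a maximal abelian ideal. The isotropic ideal `a ⊓ a^⊥` vanishes, so `g =
a ⊕ a^⊥`, where `a^⊥` is a symplectic subalgebra of even dimension mapping onto `g / a`. Semisimple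
ideals cannot occur (`eq_bot_of_forall_abelian`), so maximality makes `a^⊥` act faithfully on `a`.

By closedness, `(u, v) ↦ ω([x, u], v)` is symmetric on `a`. If `dim a = 2`, this embeds `a^⊥` in a
three-dimensional space, and `finrank_orthogonal_ne_two` excludes dimension 2. Parity then leaves
nothing for `dim a = 2`. Hence there is no nonzero irreducible algebra of dimension at most 4, so
every symplectic algebra of such dimension is solvable and completely reducible. In dimension at
most 8 an irreducible algebra has `dim a ≥ 4`, so `a^⊥` is solvable, and so is `g`.

A non completely reducible algebra of dimension 8 that is not irreducible can only be reduced by a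
line, and to an irreducible algebra of dimension 6. Solvability lifts back because the second
derived ideal lies in the orthogonal of the line. -/

open Module

/-! ### Solvable extensions and abelian ideals -/

section Lie

variable {R : Type*} {L : Type u} [CommRing R] [LieRing L] [LieAlgebra R L]

theorem LieIdeal.isSolvable_of_le_subalgebra (I : LieIdeal R L) (H : LieSubalgebra R L)
    [LieAlgebra.IsSolvable H] (h : ∀ x ∈ I, x ∈ H) : LieAlgebra.IsSolvable I := by
  have h' : (I : LieSubalgebra R L) ≤ H := h
  exact Function.Injective.lieAlgebra_isSolvable (f := LieSubalgebra.inclusion h')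
    (LieSubalgebra.inclusion_injective h')

theorem LieAlgebra.isSolvable_of_derivedSeries (k : ℕ)
    [hk : LieAlgebra.IsSolvable (LieAlgebra.derivedSeries R L k)] : LieAlgebra.IsSolvable L := by
  obtain ⟨m, hm⟩ := LieAlgebra.IsSolvable.solvable R (LieAlgebra.derivedSeries R L k)
  refine LieAlgebra.IsSolvable.mk (R := R) (k := m + k) ?_
  rw [LieIdeal.derivedSeries_eq_bot_iff] at hm
  rw [LieAlgebra.derivedSeries_def, LieAlgebra.derivedSeriesOfIdeal_add]
  exact hm

/-- An extension of solvable Lie algebras is solvable. -/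
theorem LieAlgebra.isSolvable_of_surjective {L' : Type*} [LieRing L'] [LieAlgebra R L']
    (f : L →ₗ⁅R⁆ L') (hf : Function.Surjective f) [LieAlgebra.IsSolvable L'] (H : LieSubalgebra R L)
    [LieAlgebra.IsSolvable H] (hker : ∀ x, f x = 0 → x ∈ H) : LieAlgebra.IsSolvable L := by
  obtain ⟨m, hm⟩ := LieAlgebra.IsSolvable.solvable R L'
  have : LieAlgebra.IsSolvable (LieAlgebra.derivedSeries R L m) := by
    refine LieIdeal.isSolvable_of_le_subalgebra _ H fun x hx => hker x ?_
    have h1 : f x ∈ (LieAlgebra.derivedSeries R L m).map f := LieIdeal.mem_map hx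
    rw [LieIdeal.derivedSeries_map_eq m hf, hm] at h1
    simpa using h1
  exact LieAlgebra.isSolvable_of_derivedSeries (R := R) m

/-- The quotient map of a Lie algebra by an ideal, as a morphism of Lie algebras. -/
def LieIdeal.quotientMk (I : LieIdeal R L) : L →ₗ⁅R⁆ L ⧸ I where
  toLinearMap := (LieSubmodule.Quotient.mk' I : L →ₗ[R] L ⧸ I)
  map_lie' := rfl

theorem LieIdeal.quotientMk_surjective (I : LieIdeal R L) : Function.Surjective I.quotientMk :=
  LieSubmodule.Quotient.surjective_mk' I

theorem LieIdeal.quotientMk_eq_zero (I : LieIdeal R L) {x : L} : I.quotientMk x = 0 ↔ x ∈ I :=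
  LieSubmodule.Quotient.mk_eq_zero I

theorem LieIdeal.isLieAbelian_of_forall (I : LieIdeal R L)
    (h : ∀ x ∈ I, ∀ y ∈ I, ⁅x, y⁆ = 0) : IsLieAbelian I :=
  ⟨fun x y => Subtype.ext (h x x.2 y y.2)⟩

theorem LieIdeal.lie_eq_zero_of_isLieAbelian (I : LieIdeal R L) [IsLieAbelian I] {x y : L}
    (hx : x ∈ I) (hy : y ∈ I) : ⁅x, y⁆ = 0 :=
  congrArg Subtype.val (LieModule.IsTrivial.trivial (⟨x, hx⟩ : I) (⟨y, hy⟩ : I))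

/-- The last nonzero term of the derived series of `I` is an abelian ideal of the whole algebra; it
vanishes only if `I` does. -/
theorem LieIdeal.eq_bot_of_forall_abelian_le (I : LieIdeal R L) [LieAlgebra.IsSolvable I]
    (h : ∀ c : LieIdeal R L, c ≤ I → (∀ x ∈ c, ∀ y ∈ c, ⁅x, y⁆ = 0) → c = ⊥) : I = ⊥ := by
  rw [← LieAlgebra.abelian_of_solvable_ideal_eq_bot_iff]
  refine h _ ?_ fun x hx y hy => ?_
  · cases hl : LieAlgebra.derivedLengthOfIdeal R L I with
    | zero => simp [LieAlgebra.derivedAbelianOfIdeal, hl]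
    | succ n =>
      simp only [LieAlgebra.derivedAbelianOfIdeal, hl]
      exact LieAlgebra.derivedSeriesOfIdeal_le_self I n
  · have := LieAlgebra.abelian_derivedAbelianOfIdeal (R := R) I
    exact LieIdeal.lie_eq_zero_of_isLieAbelian _ hx hy

end Lie

/-! ### Killing form and ideals without abelian ideals -/

section RealLie

variable {g : Type u} [LieRing g] [LieAlgebra ℝ g] [FiniteDimensional ℝ g]

theorem LieAlgebra.IsKilling.derivedSeries_one_eq_top [LieAlgebra.IsKilling ℝ g] :
    LieAlgebra.derivedSeries ℝ g 1 = ⊤ := by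
  have hc := LieIdeal.isCompl_killingCompl (LieAlgebra.derivedSeries ℝ g 1)
  have hab : ∀ x ∈ (LieAlgebra.derivedSeries ℝ g 1).killingCompl,
      ∀ y ∈ (LieAlgebra.derivedSeries ℝ g 1).killingCompl, ⁅x, y⁆ = 0 := by
    intro x hx y hy
    have h1 : ⁅x, y⁆ ∈ LieAlgebra.derivedSeries ℝ g 1 := by
      simpa using LieSubmodule.lie_mem_lie (LieSubmodule.mem_top x) (LieSubmodule.mem_top y)
    have h2 := lie_mem_right ℝ g _ x y hy
    have := hc.disjoint.le_bot ⟨h1, h2⟩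
    simpa using this
  have := LieIdeal.isLieAbelian_of_forall _ hab
  have hbot := LieAlgebra.IsKilling.ideal_eq_bot_of_isLieAbelian
    (LieAlgebra.derivedSeries ℝ g 1).killingCompl
  have := hc.sup_eq_top
  rwa [hbot, sup_bot_eq] at this

/-- By Cartan's criterion the intersection is solvable, so if nonzero it would contain a nonzero
abelian ideal of `g`. -/
theorem LieIdeal.disjoint_killingCompl_of_forall_abelian (k : LieIdeal ℝ g)
    (h : ∀ c : LieIdeal ℝ g, c ≤ k → (∀ x ∈ c, ∀ y ∈ c, ⁅x, y⁆ = 0) → c = ⊥) :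
    k ⊓ k.killingCompl = ⊥ := by
  have : LieAlgebra.IsSolvable (k ⊓ k.killingCompl : LieIdeal ℝ g) := by
    apply LieIdeal.isSolvable_of_killingForm_apply_lie_eq_zero
    intro x hx y hy
    have hy' := (LieSubmodule.lie_le_left _ _ hy : y ∈ k ⊓ k.killingCompl)
    exact (LieIdeal.mem_killingCompl ℝ g k).1 hy'.2 x hx.1
  exact LieIdeal.eq_bot_of_forall_abelian_le _ fun c hc => h c (hc.trans inf_le_left)

theorem LieIdeal.isKilling_of_forall_abelian (k : LieIdeal ℝ g)
    (h : ∀ c : LieIdeal ℝ g, c ≤ k → (∀ x ∈ c, ∀ y ∈ c, ⁅x, y⁆ = 0) → c = ⊥) :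
    LieAlgebra.IsKilling ℝ k := by
  refine ⟨(LieSubmodule.eq_bot_iff _).2 fun x hx => ?_⟩
  have hx' : (x : g) ∈ k ⊓ k.killingCompl := by
    refine ⟨x.2, (LieIdeal.mem_killingCompl ℝ g k).2 fun y hy => ?_⟩
    have := (LieIdeal.mem_killingCompl ℝ k ⊤).1 hx ⟨y, hy⟩ (LieSubmodule.mem_top _)
    rw [LieIdeal.killingForm_eq] at this
    exact this
  rw [k.disjoint_killingCompl_of_forall_abelian h] at hx'
  exact Subtype.ext (by simpa using hx')

end RealLie

/-! ### Semisimple ideals of symplectic Lie algebras -/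

namespace SymplecticForm

variable {g : Type u} [LieRing g] [LieAlgebra ℝ g]

theorem form_isRefl (ω : SymplecticForm g) : ω.form.IsRefl := fun a b hab => by rw [ω.skew, hab, neg_zero]

theorem form_nondegenerate (ω : SymplecticForm g) : ω.form.Nondegenerate := by
  refine ⟨ω.nondegenerate, fun a ha => ω.nondegenerate a fun b => ?_⟩
  rw [ω.skew, ha, neg_zero]

/-- A skew-symmetric matrix of odd size has determinant zero. -/
theorem even_finrank [FiniteDimensional ℝ g] (ω : SymplecticForm g) : Even (finrank ℝ g) := by
  have hdet := (LinearMap.BilinForm.nondegenerate_iff_det_ne_zero (finBasis ℝ g)).1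
    ω.form_nondegenerate
  set A := LinearMap.BilinForm.toMatrix (finBasis ℝ g) ω.form with hA
  have hAt : A.transpose = -A := by
    ext i j
    simp only [hA, Matrix.transpose_apply, Matrix.neg_apply, LinearMap.BilinForm.toMatrix_apply]
    exact ω.skew _ _
  have h1 := congrArg Matrix.det hAt
  rw [Matrix.det_transpose, Matrix.det_neg, Fintype.card_fin] at h1
  by_contra hodd
  rw [Nat.not_even_iff_odd] at hodd
  rw [hodd.neg_one_pow] at h1
  exact hdet (by linarith)

/-- The restriction of a symplectic form to a nondegenerate subalgebra. -/
def restrict (ω : SymplecticForm g) (H : LieSubalgebra ℝ g)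
    (hH : ∀ x ∈ H, (∀ y ∈ H, ω.form x y = 0) → x = 0) : SymplecticForm H where
  form := ω.form.restrict H.toSubmodule
  alt x := ω.alt x
  nondegenerate x hx := Subtype.ext (hH x x.2 fun y hy => hx ⟨y, hy⟩)
  closed x y z := ω.closed x y z

/-- Writing `ω(x, y) = κ(D x, y)` with `κ` the Killing form, closedness says that `D` is a
derivation, hence `D = ad u`. Then `u` lies in the radical of `ω`, so `u = 0` and `ω = 0`. -/
theorem subsingleton_of_isKilling [FiniteDimensional ℝ g] (ω : SymplecticForm g)
    [LieAlgebra.IsKilling ℝ g] : Subsingleton g := by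
  have hB := LieAlgebra.IsKilling.killingForm_nondegenerate ℝ g
  have hBinv : ∀ x y z : g, killingForm ℝ g ⁅x, y⁆ z = killingForm ℝ g x ⁅y, z⁆ :=
    LieModule.traceForm_apply_lie_apply ℝ g g
  let e := LinearMap.BilinForm.toDual (killingForm ℝ g) hB
  let D : g →ₗ[ℝ] g := e.symm.toLinearMap ∘ₗ ω.form
  have hD : ∀ x y, killingForm ℝ g (D x) y = ω.form x y := fun x y =>
    LinearMap.BilinForm.apply_toDual_symm_apply (hB := hB) (ω.form x) y
  have hder : ∀ a b : g, D ⁅a, b⁆ = ⁅a, D b⁆ - ⁅b, D a⁆ := by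
    intro a b
    rw [← sub_eq_zero]
    refine hB.1 _ fun z => ?_
    have h := ω.closed a b z
    rw [map_sub, map_sub, LinearMap.sub_apply, LinearMap.sub_apply, hD,
      ← lie_skew a (D b), ← lie_skew b (D a), map_neg, map_neg, LinearMap.neg_apply,
      LinearMap.neg_apply, hBinv, hBinv, hD, hD]
    have h1 := ω.skew ⁅b, z⁆ a
    have h2 := ω.skew ⁅z, a⁆ b
    have h3 : ⁅a, z⁆ = -⁅z, a⁆ := (lie_skew _ _).symm
    rw [h3, map_neg]
    linarith
  obtain ⟨u, hu⟩ := LieDerivation.IsKilling.exists_eq_ad (⟨D, hder⟩ : LieDerivation ℝ g g)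
  have hu' : ∀ x, D x = ⁅u, x⁆ := fun x => by
    have := congrArg (fun E : LieDerivation ℝ g g => E x) hu
    simpa using this.symm
  have hzero : u = 0 := ω.nondegenerate u fun y => by
    rw [← hD, hu', lie_self, map_zero, LinearMap.zero_apply]
  refine subsingleton_of_forall_eq 0 fun x => ω.nondegenerate x fun y => ?_
  rw [← hD, hu', hzero, zero_lie, map_zero, LinearMap.zero_apply]

/-- A nonzero ideal of a symplectic Lie algebra contains a nonzero abelian ideal. -/
theorem eq_bot_of_forall_abelian [FiniteDimensional ℝ g] (ω : SymplecticForm g) (k : LieIdeal ℝ g)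
    (h : ∀ c : LieIdeal ℝ g, c ≤ k → (∀ x ∈ c, ∀ y ∈ c, ⁅x, y⁆ = 0) → c = ⊥) : k = ⊥ := by
  have hK := k.isKilling_of_forall_abelian h
  have hinf := k.disjoint_killingCompl_of_forall_abelian h
  have hcompl : IsCompl k.toSubmodule ((killingForm ℝ g).orthogonal k.toSubmodule) := by
    rw [LinearMap.BilinForm.isCompl_orthogonal_iff_disjoint
        (LieModule.traceForm_isSymm ℝ g g).isRefl,
      ← LieIdeal.toSubmodule_killingCompl, LieSubmodule.disjoint_toSubmodule, disjoint_iff, hinf]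
  -- Since `k` is perfect it suffices to take `x` a bracket in `k`; closedness applies because `k`
  -- commutes with its Killing complement. Thus `ω` stays nondegenerate on `k`.
  have hperf : ∀ x ∈ k, ∀ z ∈ k.killingCompl, ω.form x z = 0 := by
    intro x hx z hz
    have hx' : (⟨x, hx⟩ : k) ∈ (LieAlgebra.derivedSeries ℝ k 1).toSubmodule := by
      rw [LieAlgebra.IsKilling.derivedSeries_one_eq_top]
      exact LieSubmodule.mem_top _
    have hcoe := LieAlgebra.coe_derivedSeries_one_eq ℝ k
    have hx'' : (⟨x, hx⟩ : k) ∈ Submodule.span ℝ {⁅x, y⁆ | (x : k) (y : k)} := by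
      rw [← hcoe]; exact hx'
    suffices H : ∀ w ∈ Submodule.span ℝ {⁅x, y⁆ | (x : k) (y : k)}, ω.form (w : g) z = 0 from
      H _ hx''
    intro w hw
    induction hw using Submodule.span_induction with
    | mem w hw =>
      obtain ⟨a, b, rfl⟩ := hw
      have hcomm : ∀ c ∈ k, ⁅c, z⁆ = 0 := fun c hc => by
        have : ⁅c, z⁆ ∈ k ⊓ k.killingCompl :=
          ⟨lie_mem_left ℝ g k c z hc, lie_mem_right ℝ g _ c z hz⟩
        rw [hinf] at this
        simpa using this
      have hcl := ω.closed a b z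
      rw [hcomm b b.2, ← lie_skew z (a : g), hcomm a a.2] at hcl
      simpa using hcl
    | zero => simp
    | add a b _ _ ha hb => simp [ha, hb]
    | smul c a _ ha => simp [ha]
  have hsub : Subsingleton k := by
    have ω' : SymplecticForm k := ω.restrict (k : LieSubalgebra ℝ g) (by
      intro x hx hxk
      refine ω.nondegenerate x fun y => ?_
      obtain ⟨a, ha, b, hb, rfl⟩ := Submodule.mem_sup.1
        (hcompl.sup_eq_top ▸ Submodule.mem_top : y ∈ k.toSubmodule ⊔ _)
      rw [← LieIdeal.toSubmodule_killingCompl] at hb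
      rw [map_add, hxk a ha, hperf x hx b hb, add_zero])
    exact ω'.subsingleton_of_isKilling
  rw [LieSubmodule.eq_bot_iff]
  exact fun x hx => congrArg Subtype.val (Subsingleton.elim (⟨x, hx⟩ : k) 0)

end SymplecticForm

/-! ### Irreducible algebras and the splitting by an abelian ideal -/

namespace SymplecticForm

variable {g : Type u} [LieRing g] [LieAlgebra ℝ g]

/-- A symplectic Lie algebra is irreducible if it has no nonzero isotropic ideal. -/
def IsIrreducible (ω : SymplecticForm g) : Prop :=
  ∀ j : LieIdeal ℝ g, ω.IsIsotropic j → j = ⊥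

/-- The kernel of the restriction of `ω` to an abelian ideal is an ideal. -/
def abelianKer (ω : SymplecticForm g) (a : LieIdeal ℝ g)
    (ha : ∀ x ∈ a, ∀ y ∈ a, ⁅x, y⁆ = 0) : LieIdeal ℝ g where
  toSubmodule := a.toSubmodule ⊓ (ω.orthogonal a).toSubmodule
  lie_mem := by
    rintro x y ⟨hy, hy'⟩
    refine ⟨lie_mem_right ℝ g a x y hy, fun z hz => ?_⟩
    have h := ω.closed x y z
    have h1 : ω.form ⁅z, x⁆ y = 0 := by
      rw [ω.skew, hy' _ (lie_mem_left ℝ g a z x hz), neg_zero]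
    rw [ha y hy z hz, h1] at h
    simpa using h

theorem IsIrreducible.eq_zero_of_mem {ω : SymplecticForm g} (hω : ω.IsIrreducible)
    {a : LieIdeal ℝ g} (ha : ∀ x ∈ a, ∀ y ∈ a, ⁅x, y⁆ = 0) {x : g} (hx : x ∈ a)
    (h : x ∈ ω.orthogonal a) : x = 0 := by
  have hbot := hω (ω.abelianKer a ha) fun y hy z hz => hy.2 z hz.1
  have hmem : x ∈ ω.abelianKer a ha := ⟨hx, h⟩
  rw [hbot] at hmem
  simpa using hmem

theorem form_lie_comm (ω : SymplecticForm g) {a : LieIdeal ℝ g}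
    (ha : ∀ x ∈ a, ∀ y ∈ a, ⁅x, y⁆ = 0) {x u v : g}
    (hu : u ∈ a) (hv : v ∈ a) : ω.form ⁅x, u⁆ v = ω.form ⁅x, v⁆ u := by
  have h := ω.closed x u v
  rw [ha u hu v hv, ← lie_skew v x] at h
  simp only [map_zero, LinearMap.zero_apply, map_neg, LinearMap.neg_apply] at h
  linarith

/-- The elements of `a^⊥` centralizing the ideal `a` form an ideal. -/
def orthogonalCentralizer (ω : SymplecticForm g) (a : LieIdeal ℝ g) : LieIdeal ℝ g where
  carrier := {x | x ∈ ω.orthogonal a ∧ ∀ y ∈ a, ⁅x, y⁆ = 0}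
  add_mem' := fun {x y} hx hy =>
    ⟨add_mem hx.1 hy.1, fun z hz => by rw [add_lie, hx.2 z hz, hy.2 z hz, add_zero]⟩
  zero_mem' := ⟨zero_mem _, fun z _ => zero_lie z⟩
  smul_mem' := fun c x hx =>
    ⟨(ω.orthogonal a).smul_mem c hx.1, fun z hz => by rw [smul_lie, hx.2 z hz, smul_zero]⟩
  lie_mem := by
    rintro t x ⟨hx, hx'⟩
    refine ⟨fun z hz => ?_, fun y hy => ?_⟩
    · have h := ω.closed t x z
      have h1 : ω.form ⁅z, t⁆ x = 0 := by
        rw [ω.skew, hx _ (lie_mem_left ℝ g a z t hz), neg_zero]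
      rw [hx' z hz, h1] at h
      simpa using h
    · rw [lie_lie, hx' y hy, hx' _ (lie_mem_right ℝ g a t y hy), lie_zero, sub_zero]

theorem isIsotropic_of_finrank_le_one [FiniteDimensional ℝ g] (ω : SymplecticForm g)
    (j : LieIdeal ℝ g) (hj : finrank ℝ j ≤ 1) : ω.IsIsotropic j := by
  obtain ⟨v, hv⟩ := finrank_le_one_iff.1 hj
  intro x hx y hy
  obtain ⟨c, hc⟩ := hv ⟨x, hx⟩
  obtain ⟨d, hd⟩ := hv ⟨y, hy⟩
  have hc' : x = c • (v : g) := (congrArg Subtype.val hc).symm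
  have hd' : y = d • (v : g) := (congrArg Subtype.val hd).symm
  simp [hc', hd', ω.alt]

theorem finrank_add_finrank_orthogonal [FiniteDimensional ℝ g] (ω : SymplecticForm g)
    (j : LieIdeal ℝ g) : finrank ℝ j + finrank ℝ (ω.orthogonal j) = finrank ℝ g := by
  have h := LinearMap.BilinForm.finrank_orthogonal ω.form_nondegenerate j.toSubmodule
  have heq : (ω.orthogonal j).toSubmodule = ω.form.orthogonal j.toSubmodule := by
    ext x
    exact forall₂_congr fun y _ => ω.form_isRefl.eq_iff
  have h' : finrank ℝ (ω.orthogonal j) = finrank ℝ (ω.form.orthogonal j.toSubmodule) := by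
    rw [← heq]; rfl
  have hle := Submodule.finrank_le j.toSubmodule
  change finrank ℝ j.toSubmodule + _ = _
  omega

theorem exists_maximal_abelian [FiniteDimensional ℝ g] : ∃ a : LieIdeal ℝ g,
    (∀ x ∈ a, ∀ y ∈ a, ⁅x, y⁆ = 0) ∧
      ∀ b : LieIdeal ℝ g, (∀ x ∈ b, ∀ y ∈ b, ⁅x, y⁆ = 0) → a ≤ b → b ≤ a := by
  have hwf := LieSubmodule.wellFoundedGT_of_noetherian ℝ g g
  obtain ⟨a, ha, hmax⟩ := hwf.wf.has_min {a : LieIdeal ℝ g | ∀ x ∈ a, ∀ y ∈ a, ⁅x, y⁆ = 0}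
    ⟨⊥, fun x hx y _ => by rw [(LieSubmodule.mem_bot x).1 hx, zero_lie]⟩
  refine ⟨a, ha, fun b hb hab => ?_⟩
  by_contra hba
  exact hmax b hb (lt_of_le_not_ge hab hba)

/-- A maximal abelian ideal works. The kernel of the action of `a^⊥` on it is an ideal; an abelian
ideal `c` in this kernel commutes with `a`, so `c ⊔ a` is abelian and maximality puts `c` in `a ⊓
a^⊥ = 0`. -/
theorem IsIrreducible.exists_faithful_abelian [FiniteDimensional ℝ g] {ω : SymplecticForm g}
    (hω : ω.IsIrreducible) : ∃ a : LieIdeal ℝ g, (∀ x ∈ a, ∀ y ∈ a, ⁅x, y⁆ = 0) ∧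
      ∀ x ∈ ω.orthogonal a, (∀ y ∈ a, ⁅x, y⁆ = 0) → x = 0 := by
  obtain ⟨a, ha, hmax⟩ := exists_maximal_abelian (g := g)
  refine ⟨a, ha, fun x hx hx' => ?_⟩
  have hbot : ω.orthogonalCentralizer a = ⊥ := by
    refine ω.eq_bot_of_forall_abelian _ fun c hc hcab => ?_
    have hle : c ⊔ a ≤ a := by
      refine hmax _ (fun u hu v hv => ?_) le_sup_right
      obtain ⟨u₁, hu₁, u₂, hu₂, rfl⟩ := (LieSubmodule.mem_sup _ _ _).1 hu
      obtain ⟨v₁, hv₁, v₂, hv₂, rfl⟩ := (LieSubmodule.mem_sup _ _ _).1 hv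
      rw [add_lie, lie_add, lie_add, hcab u₁ hu₁ v₁ hv₁, ha u₂ hu₂ v₂ hv₂, (hc hu₁).2 v₂ hv₂,
        ← lie_skew, (hc hv₁).2 u₂ hu₂]
      simp
    rw [LieSubmodule.eq_bot_iff]
    exact fun y hy => hω.eq_zero_of_mem ha (hle (LieSubmodule.mem_sup_left hy)) (hc hy).1
  have hmem : x ∈ ω.orthogonalCentralizer a := ⟨hx, hx'⟩
  rw [hbot] at hmem
  simpa using hmem

theorem IsIrreducible.exists_add [FiniteDimensional ℝ g] {ω : SymplecticForm g}
    (hω : ω.IsIrreducible) {a : LieIdeal ℝ g} (ha : ∀ x ∈ a, ∀ y ∈ a, ⁅x, y⁆ = 0) (t : g) :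
    ∃ p ∈ ω.orthogonal a, ∃ s ∈ a, p + s = t := by
  have hdisj : (ω.orthogonal a).toSubmodule ⊓ a.toSubmodule = ⊥ :=
    (Submodule.eq_bot_iff _).2 fun x hx => hω.eq_zero_of_mem ha hx.2 hx.1
  have hsum := Submodule.finrank_sup_add_finrank_inf_eq (ω.orthogonal a).toSubmodule a.toSubmodule
  rw [hdisj, finrank_bot, add_zero] at hsum
  have h := ω.finrank_add_finrank_orthogonal a
  have htop : (ω.orthogonal a).toSubmodule ⊔ a.toSubmodule = ⊤ := by
    apply Submodule.eq_top_of_finrank_eq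
    rw [hsum, add_comm]
    exact h
  exact Submodule.mem_sup.1 (htop ▸ Submodule.mem_top : t ∈ _)

/-- The symplectic form induced on the orthogonal of an abelian ideal. -/
def IsIrreducible.orthogonalForm [FiniteDimensional ℝ g] {ω : SymplecticForm g}
    (hω : ω.IsIrreducible) {a : LieIdeal ℝ g} (ha : ∀ x ∈ a, ∀ y ∈ a, ⁅x, y⁆ = 0) :
    SymplecticForm (ω.orthogonal a) :=
  ω.restrict (ω.orthogonal a) fun x hx h => by
    refine ω.nondegenerate x fun t => ?_
    obtain ⟨p, hp, s, hs, rfl⟩ := hω.exists_add ha t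
    rw [map_add, h p hp, hx s hs, add_zero]

theorem IsIrreducible.isSolvable_of_orthogonal [FiniteDimensional ℝ g] {ω : SymplecticForm g}
    (hω : ω.IsIrreducible) {a : LieIdeal ℝ g} (ha : ∀ x ∈ a, ∀ y ∈ a, ⁅x, y⁆ = 0)
    [LieAlgebra.IsSolvable (ω.orthogonal a)] : LieAlgebra.IsSolvable g := by
  have hquot : LieAlgebra.IsSolvable (g ⧸ a) := by
    refine Function.Surjective.lieAlgebra_isSolvable
      (f := a.quotientMk.comp (ω.orthogonal a).incl) fun y => ?_
    obtain ⟨t, rfl⟩ := a.quotientMk_surjective y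
    obtain ⟨p, hp, s, hs, rfl⟩ := hω.exists_add ha t
    refine ⟨⟨p, hp⟩, ?_⟩
    rw [map_add, a.quotientMk_eq_zero.2 hs, add_zero]
    rfl
  have : IsLieAbelian a := a.isLieAbelian_of_forall ha
  have : LieAlgebra.IsSolvable (a : LieSubalgebra ℝ g) :=
    inferInstanceAs (LieAlgebra.IsSolvable a)
  exact LieAlgebra.isSolvable_of_surjective a.quotientMk a.quotientMk_surjective
    (a : LieSubalgebra ℝ g) fun x hx => a.quotientMk_eq_zero.1 hx

end SymplecticForm

/-- With two generators `u`, `v` of the vector space, every bracket is a multiple of `⁅u, v⁆`, so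
the derived algebra is abelian. -/
theorem LieAlgebra.isSolvable_of_finrank_le_two {g : Type u} [LieRing g] [LieAlgebra ℝ g]
    [FiniteDimensional ℝ g] (h : finrank ℝ g ≤ 2) : LieAlgebra.IsSolvable g := by
  obtain ⟨u, v, huv⟩ : ∃ u v : g, ∀ y : g, ∃ c d : ℝ, y = c • u + d • v := by
    rcases h.eq_or_lt with h2 | h1
    · let b : Module.Basis (Fin 2) ℝ g := finBasisOfFinrankEq ℝ g h2
      refine ⟨b 0, b 1, fun y => ⟨b.repr y 0, b.repr y 1, ?_⟩⟩
      rw [← Fin.sum_univ_two (fun i => b.repr y i • b i), b.sum_repr]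
    · obtain ⟨u, hu⟩ := finrank_le_one_iff.1 (Nat.le_of_lt_succ h1)
      refine ⟨u, 0, fun y => ?_⟩
      obtain ⟨c, hc⟩ := hu y
      exact ⟨c, 0, by simp [hc]⟩
  have hD : ∀ x ∈ LieAlgebra.derivedSeries ℝ g 1, ∃ c : ℝ, x = c • ⁅u, v⁆ := by
    intro x hx
    have hx' : x ∈ Submodule.span ℝ {⁅x, y⁆ | (x : g) (y : g)} := by
      rw [← LieAlgebra.coe_derivedSeries_one_eq]; exact hx
    suffices hle : Submodule.span ℝ {⁅x, y⁆ | (x : g) (y : g)} ≤ ℝ ∙ ⁅u, v⁆ by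
      obtain ⟨c, hc⟩ := Submodule.mem_span_singleton.1 (hle hx')
      exact ⟨c, hc.symm⟩
    rw [Submodule.span_le]
    rintro _ ⟨a, b, rfl⟩
    obtain ⟨c, d, rfl⟩ := huv a
    obtain ⟨c', d', rfl⟩ := huv b
    refine Submodule.mem_span_singleton.2 ⟨c * d' - d * c', ?_⟩
    have hskew : ⁅v, u⁆ = -⁅u, v⁆ := (lie_skew _ _).symm
    simp only [add_lie, lie_add, smul_lie, lie_smul, lie_self, hskew]
    module
  have : IsLieAbelian (LieAlgebra.derivedSeries ℝ g 1) := by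
    refine LieIdeal.isLieAbelian_of_forall _ fun x hx y hy => ?_
    obtain ⟨c, rfl⟩ := hD x hx
    obtain ⟨d, rfl⟩ := hD y hy
    rw [smul_lie, lie_smul, lie_self, smul_zero, smul_zero]
  exact LieAlgebra.isSolvable_of_derivedSeries (R := ℝ) 1

/-! ### Lifting from a line, and two-dimensional abelian ideals -/

namespace SymplecticForm

variable {g : Type u} [LieRing g] [LieAlgebra ℝ g]

/-- The algebra acts on the line `j` by scalars, so its derived ideal kills `j`; closedness then
makes brackets of two derived elements orthogonal to `j`. -/
theorem isSolvable_of_orthogonal_of_finrank_eq_one [FiniteDimensional ℝ g] (ω : SymplecticForm g)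
    (j : LieIdeal ℝ g) (hj : finrank ℝ j = 1) [LieAlgebra.IsSolvable (ω.orthogonal j)] :
    LieAlgebra.IsSolvable g := by
  obtain ⟨v, hv⟩ := finrank_le_one_iff.1 hj.le
  have hv' : ∀ x ∈ j, ∃ c : ℝ, x = c • (v : g) := fun x hx => by
    obtain ⟨c, hc⟩ := hv ⟨x, hx⟩
    exact ⟨c, (congrArg Subtype.val hc).symm⟩
  have hspan : ∀ x ∈ LieAlgebra.derivedSeries ℝ g 1, ⁅x, (v : g)⁆ = 0 := by
    intro x hx
    have hx' : x ∈ Submodule.span ℝ {⁅x, y⁆ | (x : g) (y : g)} := by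
      rw [← LieAlgebra.coe_derivedSeries_one_eq]; exact hx
    clear hx
    induction hx' using Submodule.span_induction with
    | mem w hw =>
      obtain ⟨a, b, rfl⟩ := hw
      obtain ⟨c, hc⟩ := hv' _ (lie_mem_right ℝ g j a v v.2)
      obtain ⟨d, hd⟩ := hv' _ (lie_mem_right ℝ g j b v v.2)
      rw [lie_lie, hc, hd, lie_smul, lie_smul, hc, hd, smul_comm, sub_self]
    | zero => exact zero_lie _
    | add a b _ _ ha hb => rw [add_lie, ha, hb, add_zero]
    | smul c a _ ha => rw [smul_lie, ha, smul_zero]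
  have hD : LieAlgebra.IsSolvable (LieAlgebra.derivedSeries ℝ g 2) := by
    refine LieIdeal.isSolvable_of_le_subalgebra _ (ω.orthogonal j) fun x hx => ?_
    rw [LieAlgebra.derivedSeries_def, LieAlgebra.derivedSeriesOfIdeal_succ,
      ← LieSubmodule.mem_toSubmodule, LieSubmodule.lieIdeal_oper_eq_linear_span'] at hx
    induction hx using Submodule.span_induction with
    | mem w hw =>
      obtain ⟨a, ha, b, hb, rfl⟩ := hw
      intro y hy
      obtain ⟨c, rfl⟩ := hv' y hy
      have h := ω.closed a b v
      rw [hspan b hb, ← lie_skew (v : g) a, hspan a ha] at h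
      simp at h
      simp [h]
    | zero => exact zero_mem _
    | add a b _ _ ha hb => exact add_mem ha hb
    | smul c a _ ha => exact (ω.orthogonal j).smul_mem c ha
  exact LieAlgebra.isSolvable_of_derivedSeries (R := ℝ) 2

theorem IsIrreducible.finrank_orthogonal_le_three [FiniteDimensional ℝ g] {ω : SymplecticForm g}
    (hω : ω.IsIrreducible) {a : LieIdeal ℝ g} (ha : ∀ x ∈ a, ∀ y ∈ a, ⁅x, y⁆ = 0)
    (hfaith : ∀ x ∈ ω.orthogonal a, (∀ y ∈ a, ⁅x, y⁆ = 0) → x = 0) (hdim : finrank ℝ a = 2) :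
    finrank ℝ (ω.orthogonal a) ≤ 3 := by
  let b : Module.Basis (Fin 2) ℝ a := finBasisOfFinrankEq ℝ a hdim
  let β : g → g → g →ₗ[ℝ] ℝ := fun u v =>
    (ω.form.flip v) ∘ₗ (LieModule.toEnd ℝ g g : g →ₗ[ℝ] End ℝ g).flip u
  have hβ : ∀ u v x, β u v x = ω.form ⁅x, u⁆ v := fun _ _ _ => rfl
  -- The three coefficients of the symmetric form `(u, v) ↦ ω([x, u], v)` on `a`; if they vanish,
  -- then `[x, a]` lies in `a ⊓ a^⊥ = 0`.
  let φ : ω.orthogonal a →ₗ[ℝ] Fin 3 → ℝ :=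
    (LinearMap.pi ![β (b 0) (b 0), β (b 0) (b 1), β (b 1) (b 1)]) ∘ₗ
      (ω.orthogonal a).toSubmodule.subtype
  have hφ : Function.Injective φ := by
    rw [injective_iff_map_eq_zero]
    rintro ⟨x, hx⟩ h
    have h0 : ω.form ⁅x, (b 0 : g)⁆ (b 0) = 0 := congrFun h 0
    have h1 : ω.form ⁅x, (b 0 : g)⁆ (b 1) = 0 := congrFun h 1
    have h2 : ω.form ⁅x, (b 1 : g)⁆ (b 1) = 0 := congrFun h 2
    have h3 : ω.form ⁅x, (b 1 : g)⁆ (b 0) = 0 := by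
      rw [ω.form_lie_comm ha (b 1).2 (b 0).2, h1]
    have hrepr : ∀ y ∈ a, ∃ c d : ℝ, y = c • (b 0 : g) + d • (b 1 : g) := fun y hy => by
      have := b.sum_repr ⟨y, hy⟩
      rw [Fin.sum_univ_two] at this
      exact ⟨_, _, (congrArg Subtype.val this).symm⟩
    refine Subtype.ext (hfaith x hx fun y hy => ?_)
    refine hω.eq_zero_of_mem ha (lie_mem_right ℝ g a x y hy) fun z hz => ?_
    obtain ⟨c, d, rfl⟩ := hrepr y hy
    obtain ⟨c', d', rfl⟩ := hrepr z hz
    simp [h0, h1, h2, h3]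
  simpa using LinearMap.finrank_le_finrank_of_injective hφ

/-- In an irreducible symplectic Lie algebra, an element of `a^⊥` which is normalized up to
scalars acts injectively on the two-dimensional abelian ideal `a`. -/
theorem IsIrreducible.eq_zero_of_lie_eq_zero [FiniteDimensional ℝ g] {ω : SymplecticForm g}
    (hω : ω.IsIrreducible) {a : LieIdeal ℝ g} (ha : ∀ x ∈ a, ∀ y ∈ a, ⁅x, y⁆ = 0)
    (hfaith : ∀ x ∈ ω.orthogonal a, (∀ y ∈ a, ⁅x, y⁆ = 0) → x = 0) (hdim : finrank ℝ a = 2)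
    {e : g} (he : e ∈ ω.orthogonal a) (he0 : e ≠ 0)
    (hn : ∀ x ∈ ω.orthogonal a, ∃ c : ℝ, ⁅x, e⁆ = c • e) {u : g} (hu : u ∈ a)
    (heu : ⁅e, u⁆ = 0) : u = 0 := by
  let c : LieIdeal ℝ g :=
    { toSubmodule := a.toSubmodule ⊓ LinearMap.ker (LieModule.toEnd ℝ g g e)
      lie_mem := by
        rintro t w ⟨hw, hew⟩
        have hew' : ⁅e, w⁆ = 0 := hew
        refine ⟨lie_mem_right ℝ g a t w hw, ?_⟩
        change ⁅e, ⁅t, w⁆⁆ = 0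
        -- The `a`-part of `t` kills `w`, while the `a^⊥`-part preserves the line of `e` and hence
        -- its kernel.
        obtain ⟨p, hp, s, hs, rfl⟩ := hω.exists_add ha t
        obtain ⟨r, hr⟩ := hn p hp
        rw [add_lie, ha s hs w hw, add_zero, leibniz_lie, hew', lie_zero, ← lie_skew e p, hr, neg_lie,
          smul_lie, hew', smul_zero, neg_zero, add_zero] }
  have hmem : ∀ w, w ∈ c ↔ w ∈ a ∧ ⁅e, w⁆ = 0 := fun w => Iff.rfl
  have hca : c ≤ a := fun w hw => hw.1
  have hle : finrank ℝ c ≤ finrank ℝ a := Submodule.finrank_mono (s := c.toSubmodule) hca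
  by_cases h2 : finrank ℝ c = 2
  · have heq : c.toSubmodule = a.toSubmodule :=
      Submodule.eq_of_le_of_finrank_eq hca (h2.trans hdim.symm)
    refine absurd (hfaith e he fun y hy => ?_) he0
    have : y ∈ c.toSubmodule := heq ▸ hy
    exact this.2
  · have hbot := hω c (ω.isIsotropic_of_finrank_le_one c (by omega))
    have : u ∈ c := (hmem u).2 ⟨hu, heu⟩
    rw [hbot] at this
    simpa using this

theorem IsIrreducible.finrank_orthogonal_ne_two [FiniteDimensional ℝ g] {ω : SymplecticForm g}
    (hω : ω.IsIrreducible) {a : LieIdeal ℝ g} (ha : ∀ x ∈ a, ∀ y ∈ a, ⁅x, y⁆ = 0)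
    (hfaith : ∀ x ∈ ω.orthogonal a, (∀ y ∈ a, ⁅x, y⁆ = 0) → x = 0) (hdim : finrank ℝ a = 2) :
    finrank ℝ (ω.orthogonal a) ≠ 2 := by
  intro hq
  let b : Module.Basis (Fin 2) ℝ (ω.orthogonal a) := finBasisOfFinrankEq ℝ _ hq
  have hrepr : ∀ y ∈ ω.orthogonal a, ∃ c d : ℝ, y = c • (b 0 : g) + d • (b 1 : g) := fun y hy => by
    have := b.sum_repr ⟨y, hy⟩
    rw [Fin.sum_univ_two] at this
    exact ⟨_, _, (congrArg Subtype.val this).symm⟩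
  set e : g := ⁅(b 0 : g), (b 1 : g)⁆ with he
  have heq : e ∈ ω.orthogonal a := (ω.orthogonal a).lie_mem (b 0).2 (b 1).2
  have hlie : ∀ x ∈ ω.orthogonal a, ∀ y ∈ ω.orthogonal a, ∃ c : ℝ, ⁅x, y⁆ = c • e := by
    intro x hx y hy
    obtain ⟨c, d, rfl⟩ := hrepr x hx
    obtain ⟨c', d', rfl⟩ := hrepr y hy
    refine ⟨c * d' - d * c', ?_⟩
    have hskew : ⁅(b 1 : g), (b 0 : g)⁆ = -e := (lie_skew _ _).symm
    simp only [add_lie, lie_add, smul_lie, lie_smul, lie_self, hskew, ← he]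
    module
  -- Abelian case: evaluation at any nonzero `u` is a bijection from `a^⊥` to `a`, so some `y` fixes
  -- `u` and, by commutativity, acts as the identity. Then `ω` is both symmetric and alternating on
  -- `a`, contradicting its nondegeneracy there.
  by_cases he0 : e = 0
  · have hab : ∀ x ∈ ω.orthogonal a, ∀ y ∈ ω.orthogonal a, ⁅x, y⁆ = 0 := fun x hx y hy => by
      obtain ⟨c, hc⟩ := hlie x hx y hy
      rw [hc, he0, smul_zero]
    have : Nontrivial a := nontrivial_of_finrank_pos (R := ℝ) (by omega)
    obtain ⟨u, hu⟩ := exists_ne (0 : a)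
    let ψ : ω.orthogonal a →ₗ[ℝ] a :=
      (LieModule.toEnd ℝ g a : g →ₗ[ℝ] End ℝ a).flip u ∘ₗ (ω.orthogonal a).toSubmodule.subtype
    have hψ : ∀ x, (ψ x : g) = ⁅(x : g), (u : g)⁆ := fun _ => rfl
    have hinj : Function.Injective ψ := by
      rw [injective_iff_map_eq_zero]
      intro x hx
      by_contra hx0
      refine hu (Subtype.ext (hω.eq_zero_of_lie_eq_zero ha hfaith hdim x.2
        (fun h => hx0 (Subtype.ext h)) (fun y hy => ⟨0, ?_⟩) u.2 ?_))
      · rw [hab y hy x x.2, zero_smul]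
      · rw [← hψ, hx]; rfl
    have hsurj : Function.Surjective ψ :=
      (LinearMap.injective_iff_surjective_of_finrank_eq_finrank (hq.trans hdim.symm)).1 hinj
    obtain ⟨y, hy⟩ := hsurj u
    have hyu : ⁅(y : g), (u : g)⁆ = u := by rw [← hψ, hy]
    have hid : ∀ v ∈ a, ⁅(y : g), v⁆ = v := by
      intro v hv
      obtain ⟨x, hx⟩ := hsurj ⟨v, hv⟩
      have hxu : ⁅(x : g), (u : g)⁆ = v := by rw [← hψ, hx]
      rw [← hxu, leibniz_lie, hyu, hab y y.2 x x.2, zero_lie, zero_add]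
    refine hu (Subtype.ext (hω.eq_zero_of_mem ha u.2 fun v hv => ?_))
    have h := ω.form_lie_comm (x := y) ha u.2 hv
    rw [hyu, hid v hv] at h
    have := ω.skew v u
    linarith
  -- Non-abelian case: were `e` central in `a^⊥`, its two coordinates would vanish, as `[b 0, e] = s
  -- e` and `[b 1, e] = -r e`.
  · obtain ⟨f, hf, c, hc, hfe⟩ : ∃ f ∈ ω.orthogonal a, ∃ c : ℝ, c ≠ 0 ∧ ⁅f, e⁆ = c • e := by
      by_contra! hcon
      have hzero : ∀ f ∈ ω.orthogonal a, ⁅f, e⁆ = 0 := fun f hf => by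
        obtain ⟨c, hc⟩ := hlie f hf e heq
        by_cases hc0 : c = 0
        · rw [hc, hc0, zero_smul]
        · exact absurd hc (hcon f hf c hc0)
      obtain ⟨r, s, hrs⟩ := hrepr e heq
      have h0 := hzero _ (b 0).2
      have h1 := hzero _ (b 1).2
      have hskew : ⁅(b 1 : g), (b 0 : g)⁆ = -e := (lie_skew _ _).symm
      rw [hrs] at h0 h1
      simp only [lie_add, lie_smul, lie_self, smul_zero, zero_add, add_zero, ← he, hskew] at h0 h1
      have hs : s = 0 := (smul_eq_zero.1 h0).resolve_right he0
      have hr : r = 0 := (smul_eq_zero.1 h1).resolve_right (neg_ne_zero.2 he0)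
      exact he0 (by rw [hrs, hr, hs]; simp)
    let E : End ℝ a := LieModule.toEnd ℝ g a e
    let F : End ℝ a := LieModule.toEnd ℝ g a f
    have hE : Function.Injective E := by
      rw [injective_iff_map_eq_zero]
      intro u hu
      exact Subtype.ext (hω.eq_zero_of_lie_eq_zero ha hfaith hdim heq he0
        (fun x hx => hlie x hx e heq) u.2 (congrArg Subtype.val hu))
    have hFE : F * E - E * F = c • E := by
      ext u
      change ⁅f, ⁅e, (u : g)⁆⁆ - ⁅e, ⁅f, (u : g)⁆⁆ = c • ⁅e, (u : g)⁆
      rw [← lie_lie, hfe, smul_lie]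
    have hEu : IsUnit E := (LinearMap.isUnit_iff_ker_eq_bot E).2 (LinearMap.ker_eq_bot.2 hE)
    obtain ⟨E', hE'⟩ := hEu.exists_left_inv
    -- Both terms on the left have trace `tr F`, whereas the right side has trace `2c`.
    have h1 : E' * (F * E) - F = c • (1 : End ℝ a) := by
      rw [← hE', ← mul_smul_comm, ← hFE, mul_sub, ← mul_assoc E' E F, hE', one_mul]
    have h2 := congrArg (LinearMap.trace ℝ a) h1
    rw [map_sub, LinearMap.trace_mul_comm, mul_assoc, mul_eq_one_comm.1 hE', mul_one, sub_self,
      map_smul, LinearMap.trace_one, hdim] at h2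
    simp at h2
    exact hc h2

end SymplecticForm

/-! ### Dimension counts and solvability in low dimension -/

namespace SymplecticForm

variable {g : Type u} [LieRing g] [LieAlgebra ℝ g]

theorem finrank_idealInOrthogonal (ω : SymplecticForm g) {j : LieIdeal ℝ g}
    (hj : ω.IsIsotropic j) : finrank ℝ (ω.idealInOrthogonal j) = finrank ℝ j := by
  refine LinearEquiv.finrank_eq
    { toFun := fun x => ⟨x.1, ω.mem_idealInOrthogonal.1 x.2⟩
      invFun := fun x => ⟨⟨x, hj x x.2⟩, ω.mem_idealInOrthogonal.2 x.2⟩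
      map_add' := fun _ _ => rfl
      map_smul' := fun _ _ => rfl
      left_inv := fun _ => rfl
      right_inv := fun _ => rfl }

variable [FiniteDimensional ℝ g]

theorem finrank_reduction_add (ω : SymplecticForm g) {j : LieIdeal ℝ g} (hj : ω.IsIsotropic j) :
    finrank ℝ (ω.ReductionCarrier j) + 2 * finrank ℝ j = finrank ℝ g := by
  have h1 := Submodule.finrank_quotient_add_finrank (ω.idealInOrthogonal j).toSubmodule
  have h2 := ω.finrank_add_finrank_orthogonal j
  have h3 := ω.finrank_idealInOrthogonal hj
  change finrank ℝ (ω.ReductionCarrier j) + finrank ℝ (ω.idealInOrthogonal j) = _ at h1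
  omega

theorem finrank_pos_of_ne_bot {j : LieIdeal ℝ g} (hj : j ≠ ⊥) : 0 < finrank ℝ j := by
  have : j.toSubmodule ≠ ⊥ := fun h => hj (by rwa [LieSubmodule.toSubmodule_eq_bot] at h)
  exact Nat.pos_of_ne_zero fun h => this (Submodule.finrank_eq_zero.1 h)

theorem isSolvable_of_reduction (ω : SymplecticForm g) {j : LieIdeal ℝ g}
    (hj1 : finrank ℝ j = 1) [LieAlgebra.IsSolvable (ω.ReductionCarrier j)] :
    LieAlgebra.IsSolvable g := by
  have hj := ω.isIsotropic_of_finrank_le_one j hj1.le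
  have h1 : LieAlgebra.IsSolvable (ω.idealInOrthogonal j :
      LieSubalgebra ℝ (ω.orthogonal j)) :=
    LieAlgebra.isSolvable_of_finrank_le_two
      ((ω.finrank_idealInOrthogonal hj).trans_le (by omega))
  have : LieAlgebra.IsSolvable (ω.orthogonal j) :=
    LieAlgebra.isSolvable_of_surjective (ω.idealInOrthogonal j).quotientMk
      (ω.idealInOrthogonal j).quotientMk_surjective
      (ω.idealInOrthogonal j : LieSubalgebra ℝ (ω.orthogonal j))
      fun x hx => (ω.idealInOrthogonal j).quotientMk_eq_zero.1 hx
  exact ω.isSolvable_of_orthogonal_of_finrank_eq_one j hj1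

/-- Otherwise `g = a` is abelian, and every line in it is an isotropic ideal. -/
theorem IsIrreducible.finrank_orthogonal_ne_zero [Nontrivial g] {ω : SymplecticForm g}
    (hω : ω.IsIrreducible) {a : LieIdeal ℝ g} (ha : ∀ x ∈ a, ∀ y ∈ a, ⁅x, y⁆ = 0) :
    finrank ℝ (ω.orthogonal a) ≠ 0 := by
  intro h
  have hsub : Subsingleton (ω.orthogonal a) := finrank_zero_iff.1 h
  have htop : ∀ t : g, t ∈ a := fun t => by
    obtain ⟨p, hp, s, hs, rfl⟩ := hω.exists_add ha t
    have : p = 0 := congrArg Subtype.val (Subsingleton.elim (⟨p, hp⟩ : ω.orthogonal a) 0)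
    rwa [this, zero_add]
  obtain ⟨v, hv⟩ := exists_ne (0 : g)
  let l : LieIdeal ℝ g :=
    { toSubmodule := ℝ ∙ v
      lie_mem := fun {x m} _ => by
        rw [ha x (htop x) m (htop m)]
        exact zero_mem (ℝ ∙ v) }
  have hbot := hω l (ω.isIsotropic_of_finrank_le_one l (finrank_span_singleton hv).le)
  have hmem : v ∈ l := Submodule.mem_span_singleton_self v
  rw [hbot] at hmem
  exact hv (by simpa using hmem)

/-- The dimension data of a faithful abelian ideal of a nonzero irreducible symplectic Lie
algebra. -/
theorem IsIrreducible.exists_abelian [Nontrivial g] {ω : SymplecticForm g}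
    (hω : ω.IsIrreducible) : ∃ a : LieIdeal ℝ g, (∀ x ∈ a, ∀ y ∈ a, ⁅x, y⁆ = 0) ∧
      finrank ℝ a + finrank ℝ (ω.orthogonal a) = finrank ℝ g ∧ finrank ℝ a ≠ 0 ∧
      finrank ℝ (ω.orthogonal a) ≠ 0 ∧ Even (finrank ℝ (ω.orthogonal a)) ∧
      (finrank ℝ a = 2 → 4 > finrank ℝ (ω.orthogonal a) ∧ finrank ℝ (ω.orthogonal a) ≠ 2) := by
  obtain ⟨a, ha, hfaith⟩ := hω.exists_faithful_abelian
  refine ⟨a, ha, ω.finrank_add_finrank_orthogonal a, fun h0 => ?_,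
    hω.finrank_orthogonal_ne_zero ha, (hω.orthogonalForm ha).even_finrank, fun h2 =>
      ⟨Nat.lt_succ_of_le (hω.finrank_orthogonal_le_three ha hfaith h2),
        hω.finrank_orthogonal_ne_two ha hfaith h2⟩⟩
  have hbot : ∀ y ∈ a, y = 0 := fun y hy => by
    have : Subsingleton a := finrank_zero_iff.1 h0
    exact congrArg Subtype.val (Subsingleton.elim (⟨y, hy⟩ : a) 0)
  obtain ⟨v, hv⟩ := exists_ne (0 : g)
  exact hv (hfaith v (fun y hy => by rw [hbot y hy, map_zero])
    fun y hy => by rw [hbot y hy, lie_zero])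

theorem IsIrreducible.finrank_eq_zero {ω : SymplecticForm g} (hω : ω.IsIrreducible)
    (h4 : finrank ℝ g ≤ 4) : finrank ℝ g = 0 := by
  by_contra h0
  have : Nontrivial g := nontrivial_of_finrank_pos (R := ℝ) (Nat.pos_of_ne_zero h0)
  obtain ⟨a, ha, h1, h2, h3, ⟨m, h4⟩, h5⟩ := hω.exists_abelian
  -- Both summands are even and nonzero, so only `2 + 2` fits, and `h5` forbids it.
  obtain ⟨n, hn⟩ := ω.even_finrank
  omega

theorem exists_isIsotropic_of_not_isIrreducible {ω : SymplecticForm g} (h : ¬ ω.IsIrreducible) :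
    ∃ j : LieIdeal ℝ g, ω.IsIsotropic j ∧ 0 < finrank ℝ j := by
  simp only [IsIrreducible, not_forall] at h
  obtain ⟨j, hj, hne⟩ := h
  exact ⟨j, hj, finrank_pos_of_ne_bot hne⟩

theorem isSolvable_of_finrank_le_four (ω : SymplecticForm g) (h4 : finrank ℝ g ≤ 4) :
    LieAlgebra.IsSolvable g := by
  by_cases h0 : finrank ℝ g ≤ 2
  · exact LieAlgebra.isSolvable_of_finrank_le_two h0
  obtain ⟨j, hj, hpos⟩ := exists_isIsotropic_of_not_isIrreducible
    fun hω : ω.IsIrreducible => h0 ((hω.finrank_eq_zero h4).trans_le (by omega))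
  have hred := ω.finrank_reduction_add hj
  by_cases hj1 : finrank ℝ j = 1
  · have : LieAlgebra.IsSolvable (ω.ReductionCarrier j) :=
      LieAlgebra.isSolvable_of_finrank_le_two (by omega)
    exact ω.isSolvable_of_reduction hj1
  -- Here `dim j = 2` since `2 * dim j ≤ 4`, and `g` is an extension of two algebras of dimension at
  -- most 2.
  · have hq := Submodule.finrank_quotient_add_finrank j.toSubmodule
    change finrank ℝ (g ⧸ j) + finrank ℝ j = _ at hq
    have h1 : LieAlgebra.IsSolvable (g ⧸ j) := LieAlgebra.isSolvable_of_finrank_le_two (by omega)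
    have h2 : LieAlgebra.IsSolvable (j : LieSubalgebra ℝ g) :=
      LieAlgebra.isSolvable_of_finrank_le_two (show finrank ℝ j ≤ 2 by omega)
    exact LieAlgebra.isSolvable_of_surjective j.quotientMk j.quotientMk_surjective
      (j : LieSubalgebra ℝ g) fun x hx => j.quotientMk_eq_zero.1 hx

theorem IsIrreducible.isSolvable {ω : SymplecticForm g} (hω : ω.IsIrreducible)
    (h8 : finrank ℝ g ≤ 8) : LieAlgebra.IsSolvable g := by
  by_cases h0 : finrank ℝ g ≤ 2
  · exact LieAlgebra.isSolvable_of_finrank_le_two h0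
  have : Nontrivial g := nontrivial_of_finrank_pos (R := ℝ) (by omega)
  obtain ⟨a, ha, h1, h2, h3, ⟨m, h4⟩, h5⟩ := hω.exists_abelian
  obtain ⟨n, hn⟩ := ω.even_finrank
  -- If `dim a^⊥ ≥ 6` then `dim a = 2`, which `h5` forbids.
  have : LieAlgebra.IsSolvable (ω.orthogonal a) :=
    (hω.orthogonalForm ha).isSolvable_of_finrank_le_four (by omega)
  exact hω.isSolvable_of_orthogonal ha

end SymplecticForm

/-! ### Sequences of reductions and the theorem -/

namespace SymplecticLieAlgebra

theorem ReducesTo.trans {S T U : SymplecticLieAlgebra.{u}} (h₁ : S.ReducesTo T)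
    (h₂ : T.ReducesTo U) : S.ReducesTo U := by
  induction h₂ with
  | refl => exact h₁
  | step _ j hj ih => exact ih.step j hj

theorem IsCompletelyReducible.of_reduction {S : SymplecticLieAlgebra.{u}}
    {j : LieIdeal ℝ S.carrier} {hj : S.omega.IsIsotropic j}
    (h : (S.reduction j hj).IsCompletelyReducible) : S.IsCompletelyReducible := by
  obtain ⟨T, hT, hsub⟩ := h
  exact ⟨T, (ReducesTo.refl.step j hj).trans hT, hsub⟩

theorem finrank_reduction_add (S : SymplecticLieAlgebra.{u}) {j : LieIdeal ℝ S.carrier}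
    (hj : S.omega.IsIsotropic j) :
    finrank ℝ (S.reduction j hj).carrier + 2 * finrank ℝ j = finrank ℝ S.carrier :=
  S.omega.finrank_reduction_add hj

theorem isCompletelyReducible_of_finrank_le_four (n : ℕ) (hn : n ≤ 4)
    (S : SymplecticLieAlgebra.{u}) (hS : finrank ℝ S.carrier = n) : S.IsCompletelyReducible := by
  induction n using Nat.strong_induction_on generalizing S with
  | _ n ih =>
    by_cases hω : S.omega.IsIrreducible
    · exact ⟨S, ReducesTo.refl, finrank_zero_iff.1 (hω.finrank_eq_zero (by omega))⟩
    · obtain ⟨j, hj, hpos⟩ := SymplecticForm.exists_isIsotropic_of_not_isIrreducible hω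
      have hred := S.finrank_reduction_add hj
      exact (ih _ (by omega) (by omega) (S.reduction j hj) rfl).of_reduction

end SymplecticLieAlgebra

theorem mainTheorem9 (S : SymplecticLieAlgebra.{u})
    (hdim : Module.finrank ℝ S.carrier = 8)
    (hS : ¬ S.IsCompletelyReducible) :
    LieAlgebra.IsSolvable S.carrier := by
  by_cases hω : S.omega.IsIrreducible
  · exact hω.isSolvable hdim.le
  obtain ⟨j, hj, hpos⟩ := SymplecticForm.exists_isIsotropic_of_not_isIrreducible hω
  have hred := S.finrank_reduction_add hj
  have hT : ¬ (S.reduction j hj).IsCompletelyReducible := fun h => hS h.of_reduction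
  -- Together with `hred` this forces `dim j = 1` and a reduction of dimension 6.
  have hgt : 4 < finrank ℝ (S.reduction j hj).carrier := by
    by_contra hle
    exact hT (SymplecticLieAlgebra.isCompletelyReducible_of_finrank_le_four _ (by omega) _ rfl)
  -- A further proper reduction would drop to dimension at most 4, where complete reducibility is
  -- automatic.
  have hirr : (S.reduction j hj).omega.IsIrreducible := by
    by_contra hω'
    obtain ⟨i, hi, hipos⟩ := SymplecticForm.exists_isIsotropic_of_not_isIrreducible hω'
    have hred' := (S.reduction j hj).finrank_reduction_add hi
    exact hT (SymplecticLieAlgebra.isCompletelyReducible_of_finrank_le_four _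
      (by omega) ((S.reduction j hj).reduction i hi) rfl).of_reduction
  have : LieAlgebra.IsSolvable (S.omega.ReductionCarrier j) := hirr.isSolvable (by omega)
  exact S.omega.isSolvable_of_reduction (j := j) (by omega)
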